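/- Let $E$ be a complex Banach space and let $(\cos(tA))_{t\in\mathbb R}$ be a strongly continuous cosine family on $E$, that is, a family of bounded linear operators on $E$ such that $\cos(0A)=I$, $\cos((s-t)A)+\cos((s+t)A)=2\cos(sA)\cos(tA)$ for all $s,t\in\mathbb R$, and $t\mapsto\cos(tA)u$ is continuous for every $u\in E$. Suppose that there is a constant $\kappa$ with $$\|\cos(tA)\|_{\mathcal L(E)}\le\kappa\cosh t\qquad(t\in\mathbb R).$$ For $\alpha>0$, $x\ge 0$ and $u\in E$ put $$\frac{\sin(\alpha xA)}{\alpha A}\,u=\int_0^x\cos(\alpha tA)u\,dt,\qquad \varphi_{\alpha A}(x)u=\int_{[-x,x]}\cos(\alpha tA)u\,\tau_x(dt),$$ where $\tau_x(dt)=\frac{dt}{2\sinh x}$ on $[-x,x]$ for $x>0$ and $\tau_0$ is the unit point mass at $0$ (so that $\frac{\sin\lambda x}{\lambda\sinh x}=\int_{[-x,x]}\cos(\lambda t)\,\tau_x(dt)$ for $x>0$ and $\lambda\in\mathbb C\setminus\{0\}$). Let $0<\alpha<1$, $1<p<\frac{2}{1+\alpha}$, and let $f:[0,\infty)\to\mathbb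 C$ belong to $L^p([0,\infty),\sinh^2x\,dx)$. Then for every $u\in E$ both integrals in $$T_{\alpha A}(f)u:=\int_0^\infty f(x)\,\varphi_{\alpha A}(x)u\,\sinh^2x\,dx=\int_0^\infty f(x)\,\frac{\sin(\alpha xA)}{\alpha A}u\,\sinh x\,dx$$ converge absolutely (as Bochner integrals in $E$), the two integrals are equal, and $u\mapsto T_{\alpha A}(f)u$ is a bounded linear operator on $E$. -/

import Mathlib

open MeasureTheory Set

/-- A strongly continuous cosine family on a Banach space `E`. One writes `cos (tA)` for `C t`. -/
structure IsCosineFamily {E : Type*} [NormedAddCommGroup E] [NormedSpace ℂ E]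
    (C : ℝ → E →L[ℂ] E) : Prop where
  map_zero : C 0 = ContinuousLinearMap.id ℂ E
  add_eq : ∀ s t : ℝ, C (s - t) + C (s + t) = (2 : ℂ) • (C s).comp (C t)
  strongly_continuous : ∀ u : E, Continuous fun t => C t u

/-- If `C` is the cosine family `t ↦ cos (tA)`, then `speed α C` is the family `t ↦ cos (tαA)`
of the operator `αA`. -/
def speed {E : Type*} [NormedAddCommGroup E] [NormedSpace ℂ E]
    (α : ℝ) (C : ℝ → E →L[ℂ] E) : ℝ → E →L[ℂ] E :=
  fun t => C (α * t)

/-- The operator `sin (xA) / A`, applied to `u`: it is `∫₀ˣ cos (tA) u dt`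
(the sine family associated with the cosine family `C t = cos (tA)`). -/
noncomputable def sinDiv {E : Type*} [NormedAddCommGroup E] [NormedSpace ℂ E]
    (C : ℝ → E →L[ℂ] E) (x : ℝ) (u : E) : E :=
  ∫ t in (0 : ℝ)..x, C t u

/-- `φ_A(x) u = ∫_{[-x,x]} cos (tA) u τ_x(dt)`, for a family `τ` of measures representing
the characters of a hypergroup on `[0, ∞)` and the cosine family `C t = cos (tA)`. -/
noncomputable def phiOp {E : Type*} [NormedAddCommGroup E] [NormedSpace ℂ E]
    (τ : ℝ → Measure ℝ) (C : ℝ → E →L[ℂ] E) (x : ℝ) (u : E) : E :=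
  ∫ t in Icc (-x) x, C t u ∂(τ x)

/-- `T_A(f) u = ∫_{[0,∞)} f(x) φ_A(x) u m(dx)`, for a hypergroup on `[0, ∞)` with Haar measure `m`
and representing measures `τ`. -/
noncomputable def transformOp {E : Type*} [NormedAddCommGroup E] [NormedSpace ℂ E]
    (m : Measure ℝ) (τ : ℝ → Measure ℝ) (C : ℝ → E →L[ℂ] E) (f : ℝ → ℂ) (u : E) : E :=
  ∫ x in Ici (0 : ℝ), f x • phiOp τ C x u ∂m

/-- The Haar measure `sinh² x dx` on `[0, ∞)` of the double coset hypergroup `SL(2,ℂ)//SU(2)`. -/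
noncomputable def haarSinhSq : Measure ℝ :=
  (volume.restrict (Ici (0 : ℝ))).withDensity fun x => ENNReal.ofReal (Real.sinh x ^ 2)

open Classical in
/-- The measures in the Laplace representation
`sin (λx) / (λ sinh x) = ∫_{[-x,x]} cos (λt) τ_x(dt)` of the characters of `SL(2,ℂ)//SU(2)`:
`τ_x(dt) = dt / (2 sinh x)` on `[-x,x]` for `x > 0`, and the unit mass at `0` for `x = 0`. -/
noncomputable def laplaceSinh (x : ℝ) : Measure ℝ :=
  if x = 0 then Measure.dirac 0
  else ENNReal.ofReal (1 / (2 * Real.sinh x)) • volume.restrict (Icc (-x) x)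

/-!
For `x > 0` one has `φ_{αA}(x) u = (sinh x)⁻¹ ∫₀ˣ cos (αtA) u dt`, because a cosine family is even
(`IsCosineFamily.map_neg`, `phiOp_laplaceSinh`). Multiplying by `sinh² x` turns the first integral
into the second one, so convergence, equality and linearity reduce to absolute convergence in
`L¹(sinh² x dx)`.

The growth bound `‖cos (tA)‖ ≤ κ cosh t` integrates to `‖sin (αxA) / (αA)‖ ≤ (κ/α) sinh (αx)`, and
`sinh (αx) / sinh x ≤ exp (-(1 - α) x)`; hence `‖φ_{αA}(x)‖ ≤ (κ/α) exp (-(1 - α) x)` for `x > 0`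
(`norm_phiOp_laplaceSinh_le`). The exponential belongs to `L^q(sinh² x dx)` as soon as
`q (1 - α) > 2` (`memLp_exp_neg_mul_haarSinhSq`), and `p < 2 / (1 + α)` says exactly that the
exponent `q` conjugate to `p` satisfies this. Hölder's inequality then gives absolute convergence
together with a bound that is linear in `‖u‖`.
-/

/-! ### The measure `sinh² x dx` -/

theorem ae_haarSinhSq_of_forall_pos {P : ℝ → Prop} (h : ∀ x, 0 < x → P x) :
    ∀ᵐ x ∂haarSinhSq, P x := by
  refine (withDensity_absolutelyContinuous _ _).ae_le ?_
  rw [restrict_Ioi_eq_restrict_Ici.symm]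
  exact (ae_restrict_mem measurableSet_Ioi).mono h

theorem integrable_haarSinhSq_iff {F : Type*} [NormedAddCommGroup F] [NormedSpace ℝ F]
    {g : ℝ → F} :
    Integrable g haarSinhSq ↔ IntegrableOn (fun x => Real.sinh x ^ 2 • g x) (Ioi 0) := by
  rw [haarSinhSq, integrable_withDensity_iff_integrable_smul'
    (Real.measurable_sinh.pow_const 2).ennreal_ofReal (ae_of_all _ fun _ => ENNReal.ofReal_lt_top),
    ← integrableOn_Ici_iff_integrableOn_Ioi]
  simp only [ENNReal.toReal_ofReal (sq_nonneg _), IntegrableOn]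

theorem integral_haarSinhSq {F : Type*} [NormedAddCommGroup F] [NormedSpace ℝ F] (g : ℝ → F) :
    ∫ x, g x ∂haarSinhSq = ∫ x in Ioi (0 : ℝ), Real.sinh x ^ 2 • g x := by
  rw [haarSinhSq, integral_withDensity_eq_integral_toReal_smul
    (Real.measurable_sinh.pow_const 2).ennreal_ofReal (ae_of_all _ fun _ => ENNReal.ofReal_lt_top),
    integral_Ici_eq_integral_Ioi]
  simp only [ENNReal.toReal_ofReal (sq_nonneg _)]

theorem restrict_Ici_haarSinhSq : haarSinhSq.restrict (Ici 0) = haarSinhSq :=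
  Measure.restrict_eq_self_of_ae_mem (ae_haarSinhSq_of_forall_pos fun _ hx => hx.le)

theorem memLp_exp_neg_mul_haarSinhSq {b q : ℝ} (hq : 0 < q) (hbq : 2 < q * b) :
    MemLp (fun x => Real.exp (-b * x)) (ENNReal.ofReal q) haarSinhSq := by
  have hm : Measurable fun x : ℝ => Real.exp (-b * x) := by fun_prop
  rw [← integrable_norm_rpow_iff hm.aestronglyMeasurable (by simpa using hq) (by simp),
    ENNReal.toReal_ofReal hq.le, integrable_haarSinhSq_iff]
  refine (integrableOn_exp_mul_Ioi (a := 2 - q * b) (by linarith) 0).mono'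
    (by fun_prop) ?_
  filter_upwards [ae_restrict_mem measurableSet_Ioi] with x hx
  have h0 : 0 < Real.sinh x := Real.sinh_pos_iff.2 hx
  have h1 : Real.sinh x ≤ Real.exp x := by
    rw [Real.sinh_eq]
    linarith [Real.exp_pos x, Real.exp_pos (-x)]
  have h2 : Real.sinh x ^ 2 ≤ Real.exp (2 * x) := by
    calc Real.sinh x ^ 2 ≤ Real.exp x ^ 2 := by gcongr
      _ = Real.exp (2 * x) := by rw [← Real.exp_nat_mul]; norm_num
  rw [Real.norm_of_nonneg (by positivity), Real.norm_of_nonneg (Real.exp_pos _).le,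
    ← Real.exp_mul, smul_eq_mul]
  calc Real.sinh x ^ 2 * Real.exp (-b * x * q)
      ≤ Real.exp (2 * x) * Real.exp (-b * x * q) := by gcongr
    _ = Real.exp ((2 - q * b) * x) := by rw [← Real.exp_add]; ring_nf

/-! ### Sine families and the operators `φ_{αA}(x)` -/

section CosineFamily

variable {E : Type*} [NormedAddCommGroup E] [NormedSpace ℂ E] {C : ℝ → E →L[ℂ] E}

theorem IsCosineFamily.map_neg (hC : IsCosineFamily C) (t : ℝ) : C (-t) = C t := by
  have h := hC.add_eq 0 t
  rw [hC.map_zero, ContinuousLinearMap.id_comp, zero_sub, zero_add, two_smul] at h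
  exact add_right_cancel h

theorem IsCosineFamily.speed (hC : IsCosineFamily C) (α : ℝ) : IsCosineFamily (speed α C) where
  map_zero := by simp [_root_.speed, hC.map_zero]
  add_eq s t := by simpa [_root_.speed, mul_sub, mul_add] using hC.add_eq (α * s) (α * t)
  strongly_continuous u := (hC.strongly_continuous u).comp (continuous_const.mul continuous_id)

theorem IsCosineFamily.continuous_sinDiv (hC : IsCosineFamily C) (u : E) :
    Continuous fun x => sinDiv C x u :=
  intervalIntegral.continuous_primitive
    (fun _ _ => (hC.strongly_continuous u).intervalIntegrable _ _) 0

theorem IsCosineFamily.sinDiv_add (hC : IsCosineFamily C) (x : ℝ) (u v : E) :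
    sinDiv C x (u + v) = sinDiv C x u + sinDiv C x v := by
  simp only [sinDiv, map_add]
  exact intervalIntegral.integral_add ((hC.strongly_continuous u).intervalIntegrable _ _)
    ((hC.strongly_continuous v).intervalIntegrable _ _)

theorem sinDiv_smul (x : ℝ) (c : ℂ) (u : E) : sinDiv C x (c • u) = c • sinDiv C x u := by
  simp only [sinDiv, map_smul, intervalIntegral.integral_smul]

theorem IsCosineFamily.phiOp_laplaceSinh (hC : IsCosineFamily C) {x : ℝ} (hx : 0 < x) (u : E) :
    phiOp laplaceSinh C x u = (Real.sinh x)⁻¹ • sinDiv C x u := by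
  have hs : 0 < Real.sinh x := Real.sinh_pos_iff.2 hx
  have hint : ∀ a b, IntervalIntegrable (fun t => C t u) volume a b :=
    fun a b => (hC.strongly_continuous u).intervalIntegrable a b
  have hsymm : ∫ t in (-x)..0, C t u = ∫ t in (0 : ℝ)..x, C t u := by
    have h := intervalIntegral.integral_comp_neg (a := 0) (b := x) fun t => C t u
    simpa only [hC.map_neg, neg_zero] using h.symm
  have htwo : ∫ t in (-x)..x, C t u = (2 : ℝ) • sinDiv C x u := by
    rw [← intervalIntegral.integral_add_adjacent_intervals (hint _ 0) (hint 0 _), hsymm, two_smul,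
      sinDiv]
  rw [phiOp, laplaceSinh, if_neg hx.ne', Measure.restrict_smul,
    Measure.restrict_restrict measurableSet_Icc, inter_self, integral_smul_measure,
    integral_Icc_eq_integral_Ioc, ← intervalIntegral.integral_of_le (by linarith), htwo, smul_smul,
    ENNReal.toReal_ofReal (by positivity)]
  congr 1
  field_simp

theorem norm_sinDiv_speed_le {κ α : ℝ} (hκ : ∀ t, ‖C t‖ ≤ κ * Real.cosh t) (hα : 0 < α)
    {x : ℝ} (hx : 0 ≤ x) (u : E) :
    ‖sinDiv (speed α C) x u‖ ≤ κ / α * ‖u‖ * Real.sinh (α * x) := by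
  have hint : ∫ t in (0 : ℝ)..x, κ * ‖u‖ * Real.cosh (α * t)
      = κ / α * ‖u‖ * Real.sinh (α * x) := by
    rw [intervalIntegral.integral_eq_sub_of_hasDerivAt
      (f := fun t => κ / α * ‖u‖ * Real.sinh (α * t))]
    · simp
    · intro t _
      have h := (((hasDerivAt_id t).const_mul α).sinh).const_mul (κ / α * ‖u‖)
      refine h.congr_deriv ?_
      simp only [id]
      field_simp
    · exact Continuous.intervalIntegrable (by fun_prop) _ _
  rw [← hint, sinDiv]
  refine intervalIntegral.norm_integral_le_of_norm_le hx (ae_of_all _ fun t _ => ?_)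
    (Continuous.intervalIntegrable (by fun_prop) _ _)
  calc ‖C (α * t) u‖ ≤ ‖C (α * t)‖ * ‖u‖ := (C (α * t)).le_opNorm u
    _ ≤ κ * Real.cosh (α * t) * ‖u‖ := by gcongr; exact hκ _
    _ = κ * ‖u‖ * Real.cosh (α * t) := by ring

theorem sinh_mul_le_exp_neg_mul_sinh {α x : ℝ} (hα : α ≤ 1) (hx : 0 ≤ x) :
    Real.sinh (α * x) ≤ Real.exp (-(1 - α) * x) * Real.sinh x := by
  have h1 : Real.exp (-(1 - α) * x) * Real.exp x = Real.exp (α * x) := by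
    rw [← Real.exp_add]; ring_nf
  have h2 : Real.exp (-(1 - α) * x) * Real.exp (-x) ≤ Real.exp (-(α * x)) := by
    rw [← Real.exp_add, Real.exp_le_exp]
    nlinarith [mul_nonneg (sub_nonneg.2 hα) hx]
  rw [Real.sinh_eq, Real.sinh_eq]
  linarith

theorem norm_phiOp_laplaceSinh_le (hC : IsCosineFamily C) {κ α : ℝ}
    (hκ : ∀ t, ‖C t‖ ≤ κ * Real.cosh t) (hα0 : 0 < α) (hα1 : α ≤ 1) {x : ℝ} (hx : 0 < x) (u : E) :
    ‖phiOp laplaceSinh (speed α C) x u‖ ≤ κ / α * ‖u‖ * Real.exp (-(1 - α) * x) := by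
  have hs : 0 < Real.sinh x := Real.sinh_pos_iff.2 hx
  have hκ0 : 0 ≤ κ := by simpa using (norm_nonneg _).trans (hκ 0)
  rw [(hC.speed α).phiOp_laplaceSinh hx, norm_smul, Real.norm_of_nonneg (by positivity),
    inv_mul_le_iff₀ hs]
  calc ‖sinDiv (speed α C) x u‖ ≤ κ / α * ‖u‖ * Real.sinh (α * x) :=
        norm_sinDiv_speed_le hκ hα0 hx.le u
    _ ≤ κ / α * ‖u‖ * (Real.exp (-(1 - α) * x) * Real.sinh x) := by
        gcongr; exact sinh_mul_le_exp_neg_mul_sinh hα1 hx.le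
    _ = Real.sinh x * (κ / α * ‖u‖ * Real.exp (-(1 - α) * x)) := by ring

theorem IsCosineFamily.aestronglyMeasurable_phiOp (hC : IsCosineFamily C) (u : E) :
    AEStronglyMeasurable (fun x => phiOp laplaceSinh C x u) haarSinhSq := by
  have h : AEStronglyMeasurable (fun x => (Real.sinh x)⁻¹ • sinDiv C x u) haarSinhSq :=
    Real.measurable_sinh.inv.aestronglyMeasurable.smul (hC.continuous_sinDiv u).aestronglyMeasurable
  exact h.congr (ae_haarSinhSq_of_forall_pos fun x hx => (hC.phiOp_laplaceSinh hx u).symm)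

theorem IsCosineFamily.sinh_sq_smul_phiOp (hC : IsCosineFamily C) {x : ℝ} (hx : 0 < x) (z : ℂ)
    (u : E) : Real.sinh x ^ 2 • z • phiOp laplaceSinh C x u
      = (z * (Real.sinh x : ℂ)) • sinDiv C x u := by
  have hs : (Real.sinh x : ℂ) ≠ 0 := Complex.ofReal_ne_zero.2 (Real.sinh_pos_iff.2 hx).ne'
  rw [hC.phiOp_laplaceSinh hx]
  simp only [← Complex.coe_smul, smul_smul]
  congr 1
  push_cast
  field_simp

theorem IsCosineFamily.integrable_haarSinhSq_smul_phiOp_iff (hC : IsCosineFamily C) (f : ℝ → ℂ)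
    (u : E) : Integrable (fun x => f x • phiOp laplaceSinh C x u) haarSinhSq ↔
      IntegrableOn (fun x => (f x * (Real.sinh x : ℂ)) • sinDiv C x u) (Ioi 0) := by
  rw [integrable_haarSinhSq_iff]
  exact integrableOn_congr_fun (fun x hx => hC.sinh_sq_smul_phiOp hx (f x) u) measurableSet_Ioi

theorem IsCosineFamily.transformOp_eq_integral_sinDiv (hC : IsCosineFamily C) (f : ℝ → ℂ) (u : E) :
    transformOp haarSinhSq laplaceSinh C f u =
      ∫ x in Ioi (0 : ℝ), (f x * (Real.sinh x : ℂ)) • sinDiv C x u := by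
  rw [transformOp, restrict_Ici_haarSinhSq, integral_haarSinhSq]
  exact setIntegral_congr_fun measurableSet_Ioi fun x hx => hC.sinh_sq_smul_phiOp hx (f x) u

end CosineFamily

/-! ### The bounded operator `T_{αA}(f)` -/

theorem corollary3p8 {E : Type*} [NormedAddCommGroup E] [NormedSpace ℂ E] [CompleteSpace E]
    (C : ℝ → E →L[ℂ] E) (hC : IsCosineFamily C)
    (κ : ℝ) (hκ : ∀ t : ℝ, ‖C t‖ ≤ κ * Real.cosh t)
    (α : ℝ) (hα0 : 0 < α) (hα1 : α < 1)
    (p : ℝ) (hp1 : 1 < p) (hp2 : p < 2 / (1 + α))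
    (f : ℝ → ℂ) (hf : MemLp f (ENNReal.ofReal p) haarSinhSq) :
    -- both integrals converge absolutely in `E`, for every vector `u`, and they agree
    (∀ u : E,
      IntegrableOn (fun x => f x • phiOp laplaceSinh (speed α C) x u) (Ici 0) haarSinhSq ∧
      IntegrableOn (fun x => (f x * (Real.sinh x : ℂ)) • sinDiv (speed α C) x u)
        (Ioi 0) volume ∧
      transformOp haarSinhSq laplaceSinh (speed α C) f u =
        ∫ x in Ioi (0 : ℝ), (f x * (Real.sinh x : ℂ)) • sinDiv (speed α C) x u) ∧
    -- and `T_{αA}(f)` is a bounded linear operator on `E`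
    ∃ T : E →L[ℂ] E, ∀ u : E,
      T u = transformOp haarSinhSq laplaceSinh (speed α C) f u := by
  have hS := hC.speed α
  -- The exponent conjugate to `p` is large enough for Hölder against `exp (-(1 - α) x)`.
  have hpq : p.HolderConjugate (p / (p - 1)) := Real.HolderConjugate.conjExponent hp1
  have hq : 2 < p / (p - 1) * (1 - α) := by
    rw [lt_div_iff₀ (by linarith)] at hp2
    rw [div_mul_eq_mul_div, lt_div_iff₀ (by linarith)]
    linarith
  have hfg : Integrable (fun x => ‖f x‖ * Real.exp (-(1 - α) * x)) haarSinhSq := by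
    have : ENNReal.HolderConjugate (ENNReal.ofReal p) (ENNReal.ofReal (p / (p - 1))) :=
      hpq.ennrealOfReal
    exact hf.norm.integrable_mul (memLp_exp_neg_mul_haarSinhSq hpq.symm.pos hq)
  have hbound : ∀ u : E, ∀ᵐ x ∂haarSinhSq, ‖f x • phiOp laplaceSinh (speed α C) x u‖
      ≤ κ / α * ‖u‖ * (‖f x‖ * Real.exp (-(1 - α) * x)) := by
    refine fun u => ae_haarSinhSq_of_forall_pos fun x hx => ?_
    rw [norm_smul]
    calc ‖f x‖ * ‖phiOp laplaceSinh (speed α C) x u‖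
        ≤ ‖f x‖ * (κ / α * ‖u‖ * Real.exp (-(1 - α) * x)) := by
          gcongr; exact norm_phiOp_laplaceSinh_le hC hκ hα0 hα1.le hx u
      _ = κ / α * ‖u‖ * (‖f x‖ * Real.exp (-(1 - α) * x)) := by ring
  have hint : ∀ u : E, Integrable (fun x => f x • phiOp laplaceSinh (speed α C) x u) haarSinhSq :=
    fun u => (hfg.const_mul _).mono'
      (hf.aestronglyMeasurable.smul (hS.aestronglyMeasurable_phiOp u)) (hbound u)
  have hint' := fun u => (hS.integrable_haarSinhSq_smul_phiOp_iff f u).1 (hint u)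
  refine ⟨fun u => ⟨(hint u).integrableOn, hint' u, hS.transformOp_eq_integral_sinDiv f u⟩, ?_⟩
  let T : E →ₗ[ℂ] E :=
    { toFun := transformOp haarSinhSq laplaceSinh (speed α C) f
      map_add' := fun u v => by
        simp only [hS.transformOp_eq_integral_sinDiv, hS.sinDiv_add, smul_add]
        exact integral_add (hint' u) (hint' v)
      map_smul' := fun c u => by
        simp only [hS.transformOp_eq_integral_sinDiv, sinDiv_smul, RingHom.id_apply,
          smul_comm _ c, integral_smul] }
  refine ⟨T.mkContinuous (κ / α * ∫ x, ‖f x‖ * Real.exp (-(1 - α) * x) ∂haarSinhSq) fun u => ?_,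
    fun u => rfl⟩
  change ‖transformOp haarSinhSq laplaceSinh (speed α C) f u‖ ≤ _
  rw [transformOp, restrict_Ici_haarSinhSq]
  refine (norm_integral_le_of_norm_le (hfg.const_mul _) (hbound u)).trans_eq ?_
  rw [integral_const_mul]
  ring
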